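/- Let $\mathbb{K}$ be a field, $m\ge 1$ and $d\ge 0$ integers. The degree of a polynomial matrix (or of one of its columns) is the largest degree of its entries, with $\deg 0=-\infty$. The leading matrix of a square matrix $A\in\mathbb{K}[y]^{k\times k}$ without zero columns has as entry $(i,j)$ the coefficient of degree $d_j$ of $A_{ij}$, where $d_j$ is the degree of column $j$; $A$ is \emph{weak Popov} if it has no zero column and its leading matrix is invertible and upper triangular. For $F\in\mathbb{K}[y]^{m\times k}$, an \emph{approximant basis of $F$ at order $\sigma$} is a matrix in $\mathbb{K}[y]^{k\times k}$ whose columns form a basis of the $\mathbb{K}[y]$-module $\{v\in\mathbb{K}[y]^{k}\mid Fv\equiv 0 \bmod y^\sigma\}$. For $H\in\mathbb{K}(y)^{m\times m}$, a \emph{right description} of $H$ is an equality $H=ND^{-1}$ with $N,D\in\mathbb{K}[y]^{m\times m}$ and $\det D\ne0$; it is \emph{irreducible} if every common right divisor of $N$ and $D$ is unimodular. A \emph{left description} is an equality $H=\hat D^{-1}\hat N$ with $\hat N,\hat D\in\mathbb{K}[y]^{m\times m}$ and $\det\hat D\neq 0$. The matrix $H$ is \emph{describable in degree $d$} if it has both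 a left and a right description with denominators ($\hat D$, resp. $D$) of degree at most $d$. It is \emph{strictly proper} if in each nonzero entry the degree of the numerator is less than that of the denominator. Let $H\in\mathbb{K}(y)^{m\times m}$ be strictly proper, and suppose that it has a power series expansion $H=\sum_{k\ge0}S_ky^k$ at $y=0$, with $S_k\in\mathbb{K}^{m\times m}$. Let $\delta$ be the determinantal degree of the module $\mathcal{D}(H)=\{v\in\mathbb{K}[y]^m\mid Hv\in\mathbb{K}[y]^m\}$, that is, the smallest degree of the determinant of a nonsingular matrix in $\mathbb{K}[y]^{m\times m}$ whose columns are in $\mathcal{D}(H)$ (equivalently, $\deg\det B$ for any basis matrix $B$ of $\mathcal{D}(H)$). Let $$F=\Big(\sum_{k=0}^{2d-1}S_ky^k\quad -I_m\Big)\in\mathbb{K}[y]^{m\times 2m},$$ and let $$P=\begin{pmatrix}D&P_1\\N&P_2\end{pmatrix}\in\mathbb{K}[y]^{2m\times 2m},$$ with blocks of size $m\times m$, be an approximant basis of $F$ at order $2d$ that is weak Popov. Then: (i) $D$ is weak Popov; $\deg N<\deg D$; the sum of the degrees of the diagonal entries of $D$ is equal to $\deg\det D$; and $\deg\det D\le\delta$.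 (ii) If $\deg\det D=\delta$ and each of the $m$ rightmost columns of $P$ has degree at least $\deg D$, then $ND^{-1}$ is an irreducible right description of $H$. (iii) If $H$ is describable in degree $d$, then $ND^{-1}$ is an irreducible right description of $H$, $\deg D\le d$, and each of the $m$ rightmost columns of $P$ has degree at least $\deg D$. -/

import Mathlib

noncomputable section

namespace MatFrac

open Polynomial

variable {K : Type*} [Field K]

/-- The degree of a polynomial matrix: the largest degree of its entries (`⊥` for the zero
matrix). -/
def matDegree {ℓ m : ℕ} (A : Matrix (Fin ℓ) (Fin m) K[X]) : WithBot ℕ :=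
  Finset.univ.sup fun i => Finset.univ.sup fun j => (A i j).degree

/-- The degree of column `j` of a polynomial matrix: the largest degree of its entries (`⊥` for
a zero column). -/
def colDegree {ℓ m : ℕ} (A : Matrix (Fin ℓ) (Fin m) K[X]) (j : Fin m) : WithBot ℕ :=
  Finset.univ.sup fun i => (A i j).degree

/-- The column leading matrix: its entry `(i, j)` is the coefficient of degree `colDegree A j` of
`A i j`. A zero column of `A` yields a zero column. -/
def leadingMatrix {m : ℕ} (A : Matrix (Fin m) (Fin m) K[X]) : Matrix (Fin m) (Fin m) K :=
  Matrix.of fun i j => (A i j).coeff ((colDegree A j).unbotD 0)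

/-- A square polynomial matrix is (column) reduced if its column leading matrix is invertible. -/
def IsColumnReduced {m : ℕ} (A : Matrix (Fin m) (Fin m) K[X]) : Prop :=
  IsUnit (leadingMatrix A).det

/-- A square polynomial matrix is in (column) weak Popov form if its column leading matrix is
invertible and upper triangular. -/
def IsWeakPopov {m : ℕ} (A : Matrix (Fin m) (Fin m) K[X]) : Prop :=
  IsColumnReduced A ∧ (leadingMatrix A).IsUpperTriangular

/-- The columns of `B` form a basis of the module `M`. -/
def IsColumnBasis {m : ℕ} (B : Matrix (Fin m) (Fin m) K[X])
    (M : Submodule K[X] (Fin m → K[X])) : Prop :=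
  LinearIndependent K[X] B.col ∧ Submodule.span K[X] (Set.range B.col) = M

/-- A polynomial matrix seen as a matrix of power series. -/
def toPowerSeries {ℓ m : ℕ} (A : Matrix (Fin ℓ) (Fin m) K[X]) :
    Matrix (Fin ℓ) (Fin m) (PowerSeries K) :=
  A.map fun p => (p : PowerSeries K)

/-- The module of the polynomial vectors `v` with `F v ≡ 0 mod y ^ σ`. -/
def approximantModule {m k : ℕ} (F : Matrix (Fin m) (Fin k) (PowerSeries K)) (σ : ℕ) :
    Submodule K[X] (Fin k → K[X]) where
  carrier := {v | ∀ i, (PowerSeries.X : PowerSeries K) ^ σ ∣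
    F.mulVec (fun j => (v j : PowerSeries K)) i}
  zero_mem' := by
    intro i
    simp [Matrix.mulVec, dotProduct]
  add_mem' := by
    intro v w hv hw i
    have h := dvd_add (hv i) (hw i)
    simpa [Matrix.mulVec, dotProduct, mul_add, Finset.sum_add_distrib] using h
  smul_mem' := by
    intro c v hv i
    have h := Dvd.dvd.mul_left (hv i) (c : PowerSeries K)
    simpa [Matrix.mulVec, dotProduct, Finset.mul_sum, mul_left_comm] using h

/-- `P` is an approximant basis of `F` at order `σ`. -/
def IsApproximantBasis {m k : ℕ} (P : Matrix (Fin k) (Fin k) K[X])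
    (F : Matrix (Fin m) (Fin k) (PowerSeries K)) (σ : ℕ) : Prop :=
  IsColumnBasis P (approximantModule F σ)

/-- A polynomial matrix seen as a matrix of rational functions. -/
def toRat {ℓ m : ℕ} (A : Matrix (Fin ℓ) (Fin m) K[X]) : Matrix (Fin ℓ) (Fin m) (RatFunc K) :=
  A.map (algebraMap K[X] (RatFunc K))

/-- `N D⁻¹` is a right fraction description of `F`. -/
def IsRightFraction {ℓ m : ℕ} (N : Matrix (Fin ℓ) (Fin m) K[X])
    (D : Matrix (Fin m) (Fin m) K[X]) (F : Matrix (Fin ℓ) (Fin m) (RatFunc K)) : Prop :=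
  D.det ≠ 0 ∧ F = toRat N * (toRat D)⁻¹

/-- `D⁻¹ N` is a left fraction description of `F`. -/
def IsLeftFraction {ℓ m : ℕ} (D : Matrix (Fin ℓ) (Fin ℓ) K[X])
    (N : Matrix (Fin ℓ) (Fin m) K[X]) (F : Matrix (Fin ℓ) (Fin m) (RatFunc K)) : Prop :=
  D.det ≠ 0 ∧ F = (toRat D)⁻¹ * toRat N

/-- `N` and `D` are right coprime: each common right divisor is unimodular. -/
def IsRightCoprime {ℓ m : ℕ} (N : Matrix (Fin ℓ) (Fin m) K[X])
    (D : Matrix (Fin m) (Fin m) K[X]) : Prop :=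
  ∀ (B : Matrix (Fin m) (Fin m) K[X]) (N' : Matrix (Fin ℓ) (Fin m) K[X])
    (D' : Matrix (Fin m) (Fin m) K[X]), N = N' * B → D = D' * B → IsUnit B.det

/-- `N D⁻¹` is an irreducible right fraction description of `F`. -/
def IsIrreducibleRightFraction {ℓ m : ℕ} (N : Matrix (Fin ℓ) (Fin m) K[X])
    (D : Matrix (Fin m) (Fin m) K[X]) (F : Matrix (Fin ℓ) (Fin m) (RatFunc K)) : Prop :=
  IsRightFraction N D F ∧ IsRightCoprime N D

/-- In each nonzero entry, the numerator has smaller degree than the denominator. -/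
def IsStrictlyProper {ℓ m : ℕ} (F : Matrix (Fin ℓ) (Fin m) (RatFunc K)) : Prop :=
  ∀ i j, F i j ≠ 0 → (F i j).num.degree < (F i j).denom.degree

/-- `F` has both a left and a right fraction description with denominators of degree at most
`d`. -/
def IsDescribable {ℓ m : ℕ} (F : Matrix (Fin ℓ) (Fin m) (RatFunc K)) (d : ℕ) : Prop :=
  (∃ (D : Matrix (Fin ℓ) (Fin ℓ) K[X]) (N : Matrix (Fin ℓ) (Fin m) K[X]),
    IsLeftFraction D N F ∧ matDegree D ≤ (d : WithBot ℕ)) ∧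
  (∃ (N : Matrix (Fin ℓ) (Fin m) K[X]) (D : Matrix (Fin m) (Fin m) K[X]),
    IsRightFraction N D F ∧ matDegree D ≤ (d : WithBot ℕ))

/-- The module of the polynomial vectors `v` such that `F v` is a polynomial vector. -/
def denomModule {ℓ m : ℕ} (F : Matrix (Fin ℓ) (Fin m) (RatFunc K)) :
    Submodule K[X] (Fin m → K[X]) where
  carrier := {v | ∃ w : Fin ℓ → K[X],
    F.mulVec (fun j => algebraMap K[X] (RatFunc K) (v j)) =
      fun i => algebraMap K[X] (RatFunc K) (w i)}
  zero_mem' := ⟨0, by ext i; simp [Matrix.mulVec, dotProduct]⟩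
  add_mem' := by
    rintro v v' ⟨w, hw⟩ ⟨w', hw'⟩
    refine ⟨w + w', ?_⟩
    ext i
    have h := congrFun hw i
    have h' := congrFun hw' i
    simp only [Matrix.mulVec, dotProduct] at h h' ⊢
    simp [mul_add, Finset.sum_add_distrib, h, h']
  smul_mem' := by
    rintro c v ⟨w, hw⟩
    refine ⟨c • w, ?_⟩
    ext i
    have h := congrFun hw i
    simp only [Matrix.mulVec, dotProduct] at h ⊢
    simp only [Pi.smul_apply, smul_eq_mul, map_mul]
    rw [← h, Finset.mul_sum]
    exact Finset.sum_congr rfl fun x _ => mul_left_comm _ _ _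

/-- The determinantal degree of a submodule of rank `m` of `K[y]^m`: the minimal degree of the
determinant of a nonsingular matrix whose columns belong to the module. The minimum is attained
exactly at the bases of the module. -/
def determinantalDegree {m : ℕ} (M : Submodule K[X] (Fin m → K[X])) : ℕ :=
  sInf {n | ∃ B : Matrix (Fin m) (Fin m) K[X],
    B.det ≠ 0 ∧ (∀ j, B.col j ∈ M) ∧ B.det.natDegree = n}

section

open scoped RatFunc

/-- `H = ∑ k, S k * y ^ k`, as an expansion in power series at `y = 0`. -/
def HasPowerSeriesExpansion {ℓ m : ℕ} (H : Matrix (Fin ℓ) (Fin m) (RatFunc K))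
    (S : ℕ → Matrix (Fin ℓ) (Fin m) K) : Prop :=
  ∀ i j, algebraMap (RatFunc K) (LaurentSeries K) (H i j) =
    HahnSeries.ofPowerSeries ℤ K (PowerSeries.mk fun k => S k i j)

end

/-- The polynomial matrix `∑ k < σ, S k * y ^ k`. -/
def truncation {ℓ m : ℕ} (S : ℕ → Matrix (Fin ℓ) (Fin m) K) (σ : ℕ) :
    Matrix (Fin ℓ) (Fin m) K[X] :=
  ∑ k ∈ Finset.range σ, (X : K[X]) ^ k • (S k).map C

/-- The block matrix `(A B)`. -/
def blockRow {m : ℕ} (A B : Matrix (Fin m) (Fin m) K[X]) : Matrix (Fin m) (Fin (m + m)) K[X] :=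
  (Matrix.fromCols A B).reindex (Equiv.refl _) finSumFinEquiv

/-- The block matrix with first block row `(A B)` and second block row `(C D)`. -/
def blockMatrix {m : ℕ} (A B C D : Matrix (Fin m) (Fin m) K[X]) :
    Matrix (Fin (m + m)) (Fin (m + m)) K[X] :=
  (Matrix.fromBlocks A B C D).reindex finSumFinEquiv finSumFinEquiv

end MatFrac

end

noncomputable section

namespace MatFrac

open Polynomial

variable {K : Type*} [Field K]

/-! Write `s j` and `r j` for the degrees of the left and right columns of `P`. The weak Popov form
puts the pivots on the diagonal: those of the left columns lie in `D`, so each column of `N` has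
degree below `s j`, and those of the right columns lie in `P₂`. Hence `D` inherits the form, and its
determinant has degree `∑ s j`.

Take a nonsingular `B` with columns in the denominator module, column reduced with degrees `t j`,
and `E = H B`; strict properness makes the columns of `E` of degree below `t j`. Then `(B; E)` lies
in the approximant module, so it equals `P (U; V)`. Predictable degrees bound `U` and `V`, and
comparing the coefficients of degree `t j` (`exists_perm_le_of_block_mul`) gives `s (σ j) ≤ t j` for
some permutation `σ`, and `r i + deg V i j < t j` wherever `V i j ≠ 0`.

With `B` of minimal determinantal degree, summation yields `deg det D ≤ δ`. In case of equality `s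
(σ j) = t j`; if moreover each `r i` is at least `deg D`, then `V = 0`, so `B = D U`, `E = N U`, and
cancelling `U` gives `H D = N`. Irreducibility is then automatic: quotients by a common right
divisor `G` still give an element `(D'; N')` of the module, and uniqueness of coordinates in the
basis `P` makes `G` invertible.

If `H` is describable in degree `d`, a reduced right denominator in place of `B` gives `s j ≤ d`.
With a left description `A⁻¹ M` and `(v; w)` in the approximant module, `deg v ≤ d`, `deg w < d`,
the vector `M v - A w = A (H v - w)` is divisible by `y ^ (2 d)` and has degree below `2 d`: it
vanishes and `H v = w`. Applied to the left columns this is `H D = N`. A right column of degree less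
than `d` would also satisfy `H v = w`, against its pivot being in `w`; so `r j ≥ d`. -/

/-- The matrix of the coefficients of degree `s j` in column `j`. -/
def coeffMatrix {κ ι : Type*} (s : ι → ℕ) (A : Matrix κ ι K[X]) : Matrix κ ι K :=
  Matrix.of fun i j => (A i j).coeff (s j)

lemma natDegree_and_coeff_prod_of_natDegree_le {ι : Type*} (T : Finset ι) (f : ι → K[X])
    (s : ι → ℕ) (h : ∀ i ∈ T, (f i).natDegree ≤ s i) :
    (∏ i ∈ T, f i).natDegree ≤ ∑ i ∈ T, s i ∧
      (∏ i ∈ T, f i).coeff (∑ i ∈ T, s i) = ∏ i ∈ T, (f i).coeff (s i) := by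
  classical
  induction T using Finset.induction_on with
  | empty => simp
  | insert a T ha ih =>
    obtain ⟨h1, h2⟩ := ih fun i hi => h i (Finset.mem_insert_of_mem hi)
    have h0 := h a (Finset.mem_insert_self a T)
    rw [Finset.prod_insert ha, Finset.sum_insert ha, Finset.prod_insert ha,
      coeff_mul_add_eq_of_natDegree_le h0 h1, h2]
    exact ⟨natDegree_mul_le.trans (add_le_add h0 h1), rfl⟩

/-! ### Degree and top coefficient of a determinant. -/

section Square

variable {ι : Type*} [Fintype ι] [DecidableEq ι]

lemma natDegree_det_le_sum (A : Matrix ι ι K[X]) (s : ι → ℕ)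
    (h : ∀ i j, (A i j).natDegree ≤ s j) : A.det.natDegree ≤ ∑ j, s j := by
  rw [Matrix.det_apply]
  refine natDegree_sum_le_of_forall_le _ _ fun σ _ => ?_
  refine (natDegree_smul_le _ _).trans ?_
  exact (natDegree_and_coeff_prod_of_natDegree_le _ _ s fun i _ => h _ i).1

lemma coeff_det_sum (A : Matrix ι ι K[X]) (s : ι → ℕ) (h : ∀ i j, (A i j).natDegree ≤ s j) :
    A.det.coeff (∑ j, s j) = (coeffMatrix s A).det := by
  rw [Matrix.det_apply, Matrix.det_apply, finsetSum_coeff]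
  refine Finset.sum_congr rfl fun σ _ => ?_
  have := (natDegree_and_coeff_prod_of_natDegree_le Finset.univ (fun i => A (σ i) i) s
    fun i _ => h _ i).2
  rcases Int.units_eq_one_or (Equiv.Perm.sign σ) with h | h <;> simp [h, coeffMatrix, this]

/-- The `s j` are only assumed to be upper bounds; a nonzero determinant of coefficients prevents
cancellation at the top degree. -/
lemma natDegree_det_of_coeffMatrix {A : Matrix ι ι K[X]} {s : ι → ℕ}
    (h : ∀ i j, (A i j).natDegree ≤ s j) (hA : (coeffMatrix s A).det ≠ 0) :
    A.det ≠ 0 ∧ A.det.natDegree = ∑ j, s j := by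
  have hc := coeff_det_sum A s h
  refine ⟨?_, (natDegree_det_le_sum A s h).antisymm (le_natDegree_of_ne_zero (by rwa [hc]))⟩
  intro h0
  rw [h0, coeff_zero] at hc
  exact hA hc.symm

end Square

/-! ### The predictable degree property. -/

section Predictable

variable {κ ι : Type*} [Fintype ι]

/-- The coefficients of the entries of `u` that contribute to degree `a` in `P u` when the
columns of `P` have degrees `s`. -/
def shiftedCoeff (s : ι → ℕ) (a : ℕ) (u : ι → K[X]) : ι → K :=
  fun j => if s j ≤ a then (u j).coeff (a - s j) else 0

lemma coeff_mulVec_of_shifted_le {P : Matrix κ ι K[X]} {s : ι → ℕ} {a : ℕ} {u : ι → K[X]}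
    (hP : ∀ i j, (P i j).natDegree ≤ s j) (hu : ∀ j, u j = 0 ∨ s j + (u j).natDegree ≤ a)
    (i : κ) : (P.mulVec u i).coeff a = (coeffMatrix s P).mulVec (shiftedCoeff s a u) i := by
  simp only [Matrix.mulVec, dotProduct, finsetSum_coeff]
  refine Finset.sum_congr rfl fun j _ => ?_
  rcases hu j with h | h
  · simp [h, shiftedCoeff]
  · have hs : s j ≤ a := by omega
    have := coeff_mul_add_eq_of_natDegree_le (hP i j) (show (u j).natDegree ≤ a - s j by omega)
    rw [Nat.add_sub_cancel' hs] at this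
    rw [this]
    simp [shiftedCoeff, hs, coeffMatrix]

lemma natDegree_mulVec_le_of_shifted_le {P : Matrix κ ι K[X]} {s : ι → ℕ} {a : ℕ}
    {u : ι → K[X]} (hP : ∀ i j, (P i j).natDegree ≤ s j)
    (hu : ∀ j, u j = 0 ∨ s j + (u j).natDegree ≤ a) (i : κ) :
    (P.mulVec u i).natDegree ≤ a := by
  simp only [Matrix.mulVec, dotProduct]
  refine natDegree_sum_le_of_forall_le _ _ fun j _ => ?_
  rcases hu j with h | h
  · simp [h]
  · exact natDegree_mul_le.trans ((Nat.add_le_add_right (hP i j) _).trans h)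

/-- Let `a` be the largest `s j + deg (u j)` over nonzero `u j`. If `a > t`, the coefficients of
degree `a` in `P u` vanish, so the invertible coefficient matrix kills a vector having a leading
coefficient of `u` among its entries. -/
lemma shifted_le_of_natDegree_mulVec_le [DecidableEq ι] {P : Matrix ι ι K[X]} {s : ι → ℕ}
    {t : ℕ} {u : ι → K[X]} (hP : ∀ i j, (P i j).natDegree ≤ s j)
    (hdet : (coeffMatrix s P).det ≠ 0) (ht : ∀ i, (P.mulVec u i).natDegree ≤ t) (j : ι) :
    u j = 0 ∨ s j + (u j).natDegree ≤ t := by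
  classical
  by_contra! hj
  obtain ⟨k, hk, hmax⟩ := Finset.exists_max_image (Finset.univ.filter fun j => u j ≠ 0)
    (fun j => s j + (u j).natDegree) ⟨j, by simpa using hj.1⟩
  simp only [Finset.mem_filter, Finset.mem_univ, true_and] at hk hmax
  have hlt : t < s k + (u k).natDegree := hj.2.trans_le (hmax j hj.1)
  have hu : ∀ j, u j = 0 ∨ s j + (u j).natDegree ≤ s k + (u k).natDegree := fun j => by
    by_cases h : u j = 0
    · exact Or.inl h
    · exact Or.inr (hmax j h)
  have h0 : (coeffMatrix s P).mulVec (shiftedCoeff s (s k + (u k).natDegree) u) = 0 := by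
    ext i
    rw [← coeff_mulVec_of_shifted_le hP hu]
    exact coeff_eq_zero_of_natDegree_lt ((ht i).trans_lt hlt)
  have := congrFun (Matrix.eq_zero_of_mulVec_eq_zero hdet h0) k
  simp [shiftedCoeff, hk] at this

end Predictable

/-! ### Column reduction. -/

section Reduction

variable {ι : Type*} [Fintype ι] [DecidableEq ι]

/-- One step of column reduction: a column of maximal degree in a linear relation between leading
coefficients is replaced by the corresponding combination of columns. -/
lemma exists_column_reduction_step {M : Submodule K[X] (ι → K[X])} {B : Matrix ι ι K[X]}
    {t : ι → ℕ} (hB : B.det ≠ 0) (hM : ∀ j, B.col j ∈ M) (ht : ∀ i j, (B i j).natDegree ≤ t j)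
    (hred : (coeffMatrix t B).det = 0) :
    ∃ (B' : Matrix ι ι K[X]) (k : ι), B'.det ≠ 0 ∧ B'.det.natDegree = B.det.natDegree ∧
      (∀ j, B'.col j ∈ M) ∧ 0 < t k ∧
      ∀ i j, (B' i j).natDegree ≤ Function.update t k (t k - 1) j := by
  classical
  obtain ⟨c, hc0, hc⟩ := Matrix.exists_mulVec_eq_zero_iff.2 hred
  obtain ⟨l, hl⟩ := Function.ne_iff.1 hc0
  obtain ⟨k, hk, hmax⟩ := Finset.exists_max_image (Finset.univ.filter fun j => c j ≠ 0)
    t ⟨l, by simpa using hl⟩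
  simp only [Finset.mem_filter, Finset.mem_univ, true_and] at hk hmax
  -- The powers of `X` align the columns at degree `t k`. The truncated subtraction is harmless: `t
  -- i ≤ t k` whenever `c i ≠ 0`.
  set u : ι → K[X] := fun i => C (c i) * X ^ (t k - t i) with hu
  have hs : ∀ j, u j = 0 ∨ t j + (u j).natDegree ≤ t k := fun j => by
    by_cases h : c j = 0
    · simp [hu, h]
    · right
      have := hmax j h
      simp only [hu, natDegree_C_mul_X_pow _ _ h]
      omega
  have hsc : shiftedCoeff t (t k) u = c := by
    ext j
    by_cases h : c j = 0
    · simp [shiftedCoeff, hu, h]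
    · simp [shiftedCoeff, hu, hmax j h]
  have hcoeff : ∀ i, (B.mulVec u i).coeff (t k) = 0 := fun i => by
    rw [coeff_mulVec_of_shifted_le ht hs, hsc, hc]; rfl
  have hdeg := natDegree_mulVec_le_of_shifted_le ht hs
  have hdet : (B.updateCol k (B.mulVec u)).det = C (c k) * B.det := by
    have := Matrix.det_updateCol_sum B k u
    simp only [smul_eq_mul] at this
    rw [show B.mulVec u = fun i => ∑ j, u j * B i j by
      ext i; simp [Matrix.mulVec, dotProduct, mul_comm], this]
    simp [hu]
  have hdet0 : (B.updateCol k (B.mulVec u)).det ≠ 0 := by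
    rw [hdet]; exact mul_ne_zero (C_ne_zero.2 hk) hB
  -- If `t k = 0`, the new column is constant with vanishing constant terms, hence zero,
  -- contradicting nonsingularity.
  have hpos : 0 < t k := by
    by_contra h
    have h0 : t k = 0 := by omega
    apply hdet0
    refine Matrix.det_eq_zero_of_column_eq_zero k fun i => ?_
    rw [Matrix.updateCol_self, eq_C_of_natDegree_le_zero ((hdeg i).trans h0.le), ← h0, hcoeff, C_0]
  refine ⟨B.updateCol k (B.mulVec u), k, hdet0, ?_, ?_, hpos, ?_⟩
  · rw [hdet, natDegree_C_mul hk]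
  · intro j
    by_cases hj : j = k
    · subst hj
      have : (B.updateCol j (B.mulVec u)).col j = ∑ i, u i • B.col i := by
        ext i
        simp [Matrix.col, Matrix.mulVec, dotProduct, mul_comm]
      rw [this]
      exact M.sum_mem fun i _ => M.smul_mem _ (hM i)
    · have : (B.updateCol k (B.mulVec u)).col j = B.col j := by
        ext i
        simp [Matrix.col, hj]
      rw [this]
      exact hM j
  · intro i j
    by_cases hj : j = k
    · subst hj
      rw [Matrix.updateCol_self, Function.update_self]
      refine Nat.le_sub_one_of_lt (lt_of_le_of_ne (hdeg i) fun h => ?_)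
      have := hcoeff i
      rw [← h, coeff_natDegree, leadingCoeff_eq_zero] at this
      rw [this, natDegree_zero] at h
      omega
    · rw [Matrix.updateCol_ne hj, Function.update_of_ne hj]
      exact ht i j

/-- Each reduction step lowers `∑ j, t j` and raises no `t j`, so the process stops and keeps the
bound `e`. -/
lemma exists_columnReduced {M : Submodule K[X] (ι → K[X])} {B : Matrix ι ι K[X]} {e : ℕ}
    (t : ι → ℕ) (hB : B.det ≠ 0) (hM : ∀ j, B.col j ∈ M)
    (ht : ∀ i j, (B i j).natDegree ≤ t j) (he : ∀ j, t j ≤ e) :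
    ∃ (B' : Matrix ι ι K[X]) (t' : ι → ℕ), B'.det ≠ 0 ∧ B'.det.natDegree = B.det.natDegree ∧
      (∀ j, B'.col j ∈ M) ∧ (∀ i j, (B' i j).natDegree ≤ t' j) ∧ (∀ j, t' j ≤ e) ∧
      (coeffMatrix t' B').det ≠ 0 := by
  induction hn : ∑ j, t j using Nat.strong_induction_on generalizing B t with
  | _ n ih =>
  by_cases hred : (coeffMatrix t B).det = 0
  · obtain ⟨B₁, k, h0, h1, h2, hk, h3⟩ := exists_column_reduction_step hB hM ht hred
    have hlt : ∑ j, Function.update t k (t k - 1) j < n := by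
      rw [← hn]
      refine Finset.sum_lt_sum (fun j _ => ?_) ⟨k, Finset.mem_univ k, ?_⟩
      · by_cases hj : j = k
        · subst hj; simp
        · simp [hj]
      · simpa using hk
    obtain ⟨B', t', g0, g1, g⟩ := ih _ hlt _ h0 h2 h3 (fun j => by
      by_cases hj : j = k
      · subst hj; simpa using (Nat.sub_le _ _).trans (he j)
      · simpa [hj] using he j) rfl
    exact ⟨B', t', g0, g1.trans h1, g⟩
  · exact ⟨B, t, hB, rfl, hM, ht, he, hred⟩

end Reduction

/-! ### Column degrees of multiples of a block matrix. -/

section Multiples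

variable {ι : Type*} [Fintype ι] [DecidableEq ι]

lemma exists_perm_apply_ne_zero {L : Matrix ι ι K} (hL : L.det ≠ 0) :
    ∃ σ : Equiv.Perm ι, ∀ j, L (σ j) j ≠ 0 := by
  rw [Matrix.det_apply] at hL
  obtain ⟨σ, -, hσ⟩ := Finset.exists_ne_zero_of_sum_ne_zero hL
  refine ⟨σ, fun j hj => hσ ?_⟩
  have h0 : ∏ i, L (σ i) i = 0 := Finset.prod_eq_zero (Finset.mem_univ j) hj
  simp [h0]

/-- Comparison of the column degrees of a block matrix `(D P₁; N P₂)` with pivots on the diagonal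
and of a multiple `(B; C)` of it with pivots in `B`. -/
lemma exists_perm_le_of_block_mul {D P₁ N P₂ U V B E : Matrix ι ι K[X]} {s r t : ι → ℕ}
    (hD : ∀ i j, (D i j).natDegree ≤ s j) (hN : ∀ i j, (N i j).degree < s j)
    (hP₁ : ∀ i j, (P₁ i j).natDegree ≤ r j) (hP₂ : ∀ i j, (P₂ i j).natDegree ≤ r j)
    (hDdet : (coeffMatrix s D).det ≠ 0) (hPdet : (coeffMatrix r P₂).det ≠ 0)
    (hB : D * U + P₁ * V = B) (hE : N * U + P₂ * V = E)
    (hBt : ∀ i j, (B i j).natDegree ≤ t j) (hBdet : (coeffMatrix t B).det ≠ 0)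
    (hEt : ∀ i j, (E i j).degree < t j) :
    (∃ σ : Equiv.Perm ι, ∀ j, s (σ j) ≤ t j) ∧
      ∀ i j, V i j = 0 ∨ r i + (V i j).natDegree < t j := by
  set P := Matrix.fromBlocks D P₁ N P₂
  have hP : ∀ i j, (P i j).natDegree ≤ Sum.elim s r j := by
    rintro (i | i) (j | j)
    · exact hD i j
    · exact hP₁ i j
    · exact natDegree_le_iff_degree_le.2 (hN i j).le
    · exact hP₂ i j
  have hcP : coeffMatrix (Sum.elim s r) P = Matrix.fromBlocks (coeffMatrix s D)
      (coeffMatrix r P₁) 0 (coeffMatrix r P₂) := by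
    ext (i | i) (j | j)
    · rfl
    · rfl
    · exact coeff_eq_zero_of_degree_lt (hN i j)
    · rfl
  have hdet : (coeffMatrix (Sum.elim s r) P).det ≠ 0 := by
    rw [hcP, Matrix.det_fromBlocks_zero₂₁]
    exact mul_ne_zero hDdet hPdet
  have hmul : ∀ j, P.mulVec (Sum.elim (fun i => U i j) fun i => V i j) =
      Sum.elim (fun i => B i j) fun i => E i j := fun j => by
    rw [Matrix.fromBlocks_mulVec, ← hB, ← hE]
    rfl
  have hsh : ∀ j k, _ := fun j k => shifted_le_of_natDegree_mulVec_le (t := t j) hP hdet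
    (u := Sum.elim (fun i => U i j) fun i => V i j) (fun i => by
      rw [hmul]
      rcases i with i | i
      · exact hBt i j
      · exact natDegree_le_iff_degree_le.2 (hEt i j).le) k
  set L₁ : Matrix ι ι K := Matrix.of fun i j => shiftedCoeff s (t j) (fun i => U i j) i
  set L₂ : Matrix ι ι K := Matrix.of fun i j => shiftedCoeff r (t j) (fun i => V i j) i
  have hco : ∀ j, Sum.elim (fun i => coeffMatrix t B i j) (fun _ => 0) =
      Sum.elim ((coeffMatrix s D).mulVec (fun i => L₁ i j) +
        (coeffMatrix r P₁).mulVec (fun i => L₂ i j))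
        ((coeffMatrix r P₂).mulVec (fun i => L₂ i j)) := fun j => by
    have h : ∀ i, _ := coeff_mulVec_of_shifted_le hP (hsh j)
    rw [hmul, hcP] at h
    have hs : shiftedCoeff (Sum.elim s r) (t j) (Sum.elim (fun i => U i j) fun i => V i j) =
        Sum.elim (fun i => L₁ i j) fun i => L₂ i j := by
      ext (i | i) <;> rfl
    rw [hs, Matrix.fromBlocks_mulVec] at h
    simp only [Matrix.zero_mulVec, zero_add, Sum.elim_comp_inl, Sum.elim_comp_inr] at h
    ext i
    rw [← h i]
    rcases i with i | i
    · rfl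
    · exact (coeff_eq_zero_of_degree_lt (hEt i j)).symm
  -- The lower block `E` contributes nothing in degree `t j`, and the lower left coefficient block
  -- is zero.
  have hL₂ : ∀ j, (fun i => L₂ i j) = 0 := fun j => by
    refine Matrix.eq_zero_of_mulVec_eq_zero hPdet ?_
    ext i
    exact (congrFun (hco j) (Sum.inr i)).symm
  have hL₁ : coeffMatrix t B = coeffMatrix s D * L₁ := by
    ext i j
    have h := congrFun (hco j) (Sum.inl i)
    simp only [hL₂, Matrix.mulVec_zero, add_zero, Sum.elim_inl] at h
    exact h
  constructor
  · have : L₁.det ≠ 0 := fun h0 => hBdet (by rw [hL₁, Matrix.det_mul, h0, mul_zero])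
    obtain ⟨σ, hσ⟩ := exists_perm_apply_ne_zero this
    refine ⟨σ, fun j => ?_⟩
    by_contra h
    exact hσ j (by simp [L₁, shiftedCoeff, h])
  · intro i j
    by_cases hV : V i j = 0
    · exact Or.inl hV
    right
    have h : r i + (V i j).natDegree ≤ t j := (hsh j (Sum.inr i)).resolve_left hV
    -- In case of equality, `L₂ i j` would be the leading coefficient of `V i j`.
    refine lt_of_le_of_ne h fun he => hV ?_
    have h0 : L₂ i j = 0 := congrFun (hL₂ j) i
    have : t j - r i = (V i j).natDegree := by omega
    simpa [L₂, shiftedCoeff, show r i ≤ t j by omega, this] using h0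

end Multiples

/-! ### Degrees at infinity. -/

section StrictlyProper

/-- A sum of rational functions of degree less than `n` is zero or of degree less than `n`. -/
lemma intDegree_sum_lt {ι : Type*} (T : Finset ι) (f : ι → RatFunc K) (n : ℤ)
    (h : ∀ i ∈ T, f i = 0 ∨ (f i).intDegree < n) :
    ∑ i ∈ T, f i = 0 ∨ (∑ i ∈ T, f i).intDegree < n := by
  classical
  induction T using Finset.induction_on with
  | empty => simp
  | insert a T ha ih =>
    rw [Finset.sum_insert ha]
    have h0 := h a (Finset.mem_insert_self a T)
    have h1 := ih fun i hi => h i (Finset.mem_insert_of_mem hi)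
    by_cases hy : ∑ i ∈ T, f i = 0
    · rw [hy, add_zero]; exact h0
    by_cases hx : f a = 0
    · rw [hx, zero_add]; exact h1
    by_cases hxy : f a + ∑ i ∈ T, f i = 0
    · exact Or.inl hxy
    · exact Or.inr ((RatFunc.intDegree_add_le hy hxy).trans_lt
        (max_lt (h0.resolve_left hx) (h1.resolve_left hy)))

lemma IsStrictlyProper.intDegree_neg {ℓ m : ℕ} {H : Matrix (Fin ℓ) (Fin m) (RatFunc K)}
    (hH : IsStrictlyProper H) {i : Fin ℓ} {j : Fin m} (h : H i j ≠ 0) :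
    (H i j).intDegree < 0 := by
  have := hH i j h
  rw [degree_eq_natDegree (RatFunc.num_ne_zero h),
    degree_eq_natDegree (RatFunc.denom_ne_zero _)] at this
  rw [RatFunc.intDegree, sub_neg]
  exact_mod_cast this

/-- Every term has degree less than `t` at infinity. Since `degree 0 = ⊥`, the case `t = 0` says
that `w = 0`. -/
lemma degree_lt_of_sum_mul {ι : Type*} [Fintype ι] {f : ι → RatFunc K} {v : ι → K[X]} {w : K[X]}
    {t : ℕ} (hf : ∀ j, f j ≠ 0 → (f j).intDegree < 0) (hv : ∀ j, (v j).natDegree ≤ t)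
    (h : ∑ j, f j * algebraMap K[X] (RatFunc K) (v j) = algebraMap K[X] (RatFunc K) w) :
    w.degree < t := by
  by_cases hw : w = 0
  · simp [hw]
  have := intDegree_sum_lt Finset.univ
    (fun j => f j * algebraMap K[X] (RatFunc K) (v j)) t fun j _ => by
      by_cases h0 : f j = 0
      · simp [h0]
      by_cases h1 : v j = 0
      · simp [h1]
      right
      rw [RatFunc.intDegree_mul h0 (RatFunc.algebraMap_ne_zero h1), RatFunc.intDegree_polynomial]
      have := hf j h0
      have := hv j
      omega
  rw [h, RatFunc.intDegree_polynomial] at this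
  rw [degree_eq_natDegree hw]
  have := this.resolve_left (RatFunc.algebraMap_ne_zero hw)
  exact_mod_cast this

end StrictlyProper

/-! ### Power series expansions and the approximant module. -/

section PowerSeries

open scoped RatFunc

variable {ℓ m : ℕ}

/-- The index maps `a` and `b` cover both a row of `H` times a vector and a vector times a column of
`H`. -/
lemma HasPowerSeriesExpansion.sum_mul {H : Matrix (Fin ℓ) (Fin m) (RatFunc K)}
    {S : ℕ → Matrix (Fin ℓ) (Fin m) K} (hS : HasPowerSeriesExpansion H S) {ι : Type*} [Fintype ι]
    (a : ι → Fin ℓ) (b : ι → Fin m) (v : ι → K[X]) (w : K[X])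
    (h : ∑ k, H (a k) (b k) * algebraMap K[X] (RatFunc K) (v k) =
      algebraMap K[X] (RatFunc K) w) :
    ∑ k, (PowerSeries.mk fun n => S n (a k) (b k)) * (v k : PowerSeries K) = w := by
  have h' := congrArg (algebraMap (RatFunc K) (LaurentSeries K)) h
  have hc : ∀ p : K[X], algebraMap (RatFunc K) (LaurentSeries K) (algebraMap K[X] (RatFunc K) p) =
      HahnSeries.ofPowerSeries ℤ K (p : PowerSeries K) := fun p => (RatFunc.coe_coe p).symm
  rw [map_sum] at h'
  simp only [map_mul, hc, hS _ _] at h'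
  apply HahnSeries.ofPowerSeries_injective (Γ := ℤ)
  simpa only [map_sum, map_mul] using h'

lemma coeff_truncation (S : ℕ → Matrix (Fin ℓ) (Fin m) K) (σ n : ℕ) (i : Fin ℓ) (j : Fin m) :
    (truncation S σ i j).coeff n = if n < σ then S n i j else 0 := by
  simp [truncation, Matrix.sum_apply]

lemma X_pow_dvd_mk_sub_truncation (S : ℕ → Matrix (Fin ℓ) (Fin m) K) (σ : ℕ) (i : Fin ℓ)
    (j : Fin m) : (PowerSeries.X : PowerSeries K) ^ σ ∣
      (truncation S σ i j : PowerSeries K) - PowerSeries.mk fun n => S n i j := by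
  rw [PowerSeries.X_pow_dvd_iff]
  intro n hn
  simp [coeff_truncation, hn]

lemma blockRow_castAdd (A B : Matrix (Fin m) (Fin m) K[X]) (i j : Fin m) :
    blockRow A B i (Fin.castAdd m j) = A i j := by
  simp [blockRow]

lemma blockRow_natAdd (A B : Matrix (Fin m) (Fin m) K[X]) (i j : Fin m) :
    blockRow A B i (Fin.natAdd m j) = B i j := by
  rw [blockRow, Matrix.reindex_apply, Matrix.submatrix_apply, finSumFinEquiv_symm_apply_natAdd]
  rfl

/-- Truncation at order `σ` is invisible modulo `y ^ σ`, so the full expansion may replace it. -/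
lemma mem_approximantModule_blockRow (S : ℕ → Matrix (Fin m) (Fin m) K) (σ : ℕ)
    (u : Fin (m + m) → K[X]) :
    u ∈ approximantModule (toPowerSeries (blockRow (truncation S σ) (-1))) σ ↔
      ∀ i, (PowerSeries.X : PowerSeries K) ^ σ ∣
        ∑ j, (PowerSeries.mk fun n => S n i j) * (u (Fin.castAdd m j) : PowerSeries K) -
          (u (Fin.natAdd m i) : PowerSeries K) := by
  refine forall_congr' fun i => ?_
  have h : (toPowerSeries (blockRow (truncation S σ) (-1))).mulVec
      (fun j => (u j : PowerSeries K)) i =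
      ∑ j, (truncation S σ i j : PowerSeries K) * (u (Fin.castAdd m j) : PowerSeries K) -
        (u (Fin.natAdd m i) : PowerSeries K) := by
    simp only [Matrix.mulVec, dotProduct, Fin.sum_univ_add, toPowerSeries, Matrix.map_apply,
      blockRow_castAdd, blockRow_natAdd, sub_eq_add_neg]
    congr 1
    rw [Finset.sum_eq_single i]
    · simp
    · intro j _ hj
      simp [Matrix.one_apply_ne hj.symm]
    · simp
  rw [h]
  refine dvd_iff_dvd_of_dvd_sub ?_
  rw [sub_sub_sub_cancel_right, ← Finset.sum_sub_distrib]
  refine Finset.dvd_sum fun j _ => ?_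
  rw [← sub_mul]
  exact (X_pow_dvd_mk_sub_truncation S σ i j).mul_right _

lemma eq_zero_of_X_pow_dvd_coe {p : K[X]} {σ : ℕ} (hp : p.degree < σ)
    (h : (PowerSeries.X : PowerSeries K) ^ σ ∣ (p : PowerSeries K)) : p = 0 := by
  ext n
  by_cases hn : n < σ
  · simpa using PowerSeries.X_pow_dvd_iff.1 h n hn
  · rw [coeff_zero]
    exact coeff_eq_zero_of_degree_lt (hp.trans_le (by exact_mod_cast not_lt.1 hn))

end PowerSeries

/-! ### Column degrees and weak Popov form. -/

section Degrees

variable {m : ℕ}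

lemma colDegree_eq_of_coeff_ne_zero {ℓ : ℕ} {A : Matrix (Fin ℓ) (Fin m) K[X]} {i : Fin ℓ}
    {j : Fin m} {t : ℕ} (h : ∀ i, (A i j).natDegree ≤ t) (hi : (A i j).coeff t ≠ 0) :
    colDegree A j = t := by
  refine le_antisymm (Finset.sup_le fun k _ => natDegree_le_iff_degree_le.1 (h k)) ?_
  exact (le_degree_of_ne_zero hi).trans
    (Finset.le_sup (f := fun i => (A i j).degree) (Finset.mem_univ i))

lemma natDegree_le_unbotD_colDegree {ℓ : ℕ} (A : Matrix (Fin ℓ) (Fin m) K[X]) (i : Fin ℓ)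
    (j : Fin m) : (A i j).natDegree ≤ (colDegree A j).unbotD 0 := by
  have h : (A i j).degree ≤ colDegree A j :=
    Finset.le_sup (f := fun i => (A i j).degree) (Finset.mem_univ i)
  refine natDegree_le_iff_degree_le.2 (h.trans ?_)
  cases colDegree A j
  · simp
  · exact le_rfl

lemma diag_ne_zero_of_det_ne_zero {L : Matrix (Fin m) (Fin m) K} (hL : L.IsUpperTriangular)
    (hdet : L.det ≠ 0) (j : Fin m) : L j j ≠ 0 := by
  rw [Matrix.det_of_isUpperTriangular hL] at hdet
  exact Finset.prod_ne_zero_iff.1 hdet j (Finset.mem_univ j)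

lemma det_ne_zero_of_diag_ne_zero {L : Matrix (Fin m) (Fin m) K} (hL : L.IsUpperTriangular)
    (hdiag : ∀ j, L j j ≠ 0) : L.det ≠ 0 := by
  rw [Matrix.det_of_isUpperTriangular hL]
  exact Finset.prod_ne_zero_iff.2 fun j _ => hdiag j

lemma IsWeakPopov.exists_degrees {A : Matrix (Fin m) (Fin m) K[X]} (hA : IsWeakPopov A) :
    ∃ t : Fin m → ℕ, (∀ i j, (A i j).natDegree ≤ t j) ∧ (∀ j, (A j j).coeff (t j) ≠ 0) ∧
      ∀ i j, j < i → (A i j).coeff (t j) = 0 :=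
  ⟨fun j => (colDegree A j).unbotD 0, natDegree_le_unbotD_colDegree A,
    fun j => diag_ne_zero_of_det_ne_zero hA.2 hA.1.ne_zero j, fun _ _ h => hA.2 h⟩

lemma leadingMatrix_eq_coeffMatrix {A : Matrix (Fin m) (Fin m) K[X]} {t : Fin m → ℕ}
    (h : ∀ i j, (A i j).natDegree ≤ t j) (hd : ∀ j, (A j j).coeff (t j) ≠ 0) :
    leadingMatrix A = coeffMatrix t A := by
  ext i j
  simp [leadingMatrix, coeffMatrix, colDegree_eq_of_coeff_ne_zero (fun i => h i j) (hd j)]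

lemma isWeakPopov_of_degrees {A : Matrix (Fin m) (Fin m) K[X]} {t : Fin m → ℕ}
    (h : ∀ i j, (A i j).natDegree ≤ t j) (hd : ∀ j, (A j j).coeff (t j) ≠ 0)
    (hu : (coeffMatrix t A).IsUpperTriangular) : IsWeakPopov A := by
  rw [IsWeakPopov, IsColumnReduced, leadingMatrix_eq_coeffMatrix h hd]
  exact ⟨(det_ne_zero_of_diag_ne_zero hu hd).isUnit, hu⟩

lemma degree_lt_of_coeff_eq_zero {p : K[X]} {t : ℕ} (h : p.natDegree ≤ t) (h0 : p.coeff t = 0) :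
    p.degree < t := by
  rw [degree_lt_iff_coeff_zero]
  intro k hk
  rcases hk.eq_or_lt with rfl | hk
  · exact h0
  · exact coeff_eq_zero_of_natDegree_lt (h.trans_lt hk)

lemma degree_eq_of_coeff_ne_zero {p : K[X]} {t : ℕ} (h : p.natDegree ≤ t) (h0 : p.coeff t ≠ 0) :
    p.degree = t :=
  (natDegree_le_iff_degree_le.1 h).antisymm (le_degree_of_ne_zero h0)

lemma matDegree_le_iff {ℓ : ℕ} {A : Matrix (Fin ℓ) (Fin m) K[X]} {a : WithBot ℕ} :
    matDegree A ≤ a ↔ ∀ i j, (A i j).degree ≤ a := by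
  simp [matDegree, Finset.sup_le_iff]

lemma degree_le_matDegree {ℓ : ℕ} (A : Matrix (Fin ℓ) (Fin m) K[X]) (i : Fin ℓ) (j : Fin m) :
    (A i j).degree ≤ matDegree A :=
  matDegree_le_iff.1 le_rfl i j

lemma matDegree_lt_of_columns {N D : Matrix (Fin m) (Fin m) K[X]} {s : Fin m → ℕ} (hm : 0 < m)
    (hN : ∀ i j, (N i j).degree < s j) (hD : ∀ j, (D j j).degree = s j) :
    matDegree N < matDegree D := by
  have hs : ∀ j, (s j : WithBot ℕ) ≤ matDegree D := fun j => hD j ▸ degree_le_matDegree D j j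
  -- The strict inequality needs a column: for `m = 0` both degrees are `⊥`.
  have hbot : (⊥ : WithBot ℕ) < matDegree D :=
    (WithBot.bot_lt_coe _).trans_le (hs ⟨0, hm⟩)
  rw [matDegree, Finset.sup_lt_iff hbot]
  intro i _
  rw [Finset.sup_lt_iff hbot]
  exact fun j _ => (hN i j).trans_le (hs j)

end Degrees

section Block

variable {m : ℕ} (A B C D : Matrix (Fin m) (Fin m) K[X]) (i j : Fin m)

lemma blockMatrix_castAdd_castAdd :
    blockMatrix A B C D (Fin.castAdd m i) (Fin.castAdd m j) = A i j := by
  rw [blockMatrix, Matrix.reindex_apply, Matrix.submatrix_apply, finSumFinEquiv_symm_apply_castAdd,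
    finSumFinEquiv_symm_apply_castAdd]
  rfl

lemma blockMatrix_castAdd_natAdd :
    blockMatrix A B C D (Fin.castAdd m i) (Fin.natAdd m j) = B i j := by
  rw [blockMatrix, Matrix.reindex_apply, Matrix.submatrix_apply, finSumFinEquiv_symm_apply_castAdd,
    finSumFinEquiv_symm_apply_natAdd]
  rfl

lemma blockMatrix_natAdd_castAdd :
    blockMatrix A B C D (Fin.natAdd m i) (Fin.castAdd m j) = C i j := by
  rw [blockMatrix, Matrix.reindex_apply, Matrix.submatrix_apply, finSumFinEquiv_symm_apply_castAdd,
    finSumFinEquiv_symm_apply_natAdd]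
  rfl

lemma blockMatrix_natAdd_natAdd :
    blockMatrix A B C D (Fin.natAdd m i) (Fin.natAdd m j) = D i j := by
  rw [blockMatrix, Matrix.reindex_apply, Matrix.submatrix_apply, finSumFinEquiv_symm_apply_natAdd,
    finSumFinEquiv_symm_apply_natAdd]
  rfl

end Block

/-! ### Pivots of a weak Popov block matrix. -/

/-- The degree pattern of a matrix `(D P₁; N P₂)` with pivots on the diagonal, `s` and `r` being
the degrees of the left and of the right columns. -/
structure BlockDegrees {m : ℕ} (D P₁ N P₂ : Matrix (Fin m) (Fin m) K[X]) (s r : Fin m → ℕ) :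
    Prop where
  natDegree_D : ∀ i j, (D i j).natDegree ≤ s j
  degree_N : ∀ i j, (N i j).degree < s j
  natDegree_P₁ : ∀ i j, (P₁ i j).natDegree ≤ r j
  natDegree_P₂ : ∀ i j, (P₂ i j).natDegree ≤ r j
  upper_D : (coeffMatrix s D).IsUpperTriangular
  diag_D : ∀ j, (D j j).coeff (s j) ≠ 0
  upper_P₂ : (coeffMatrix r P₂).IsUpperTriangular
  diag_P₂ : ∀ j, (P₂ j j).coeff (r j) ≠ 0

section BlockDegrees

variable {m : ℕ} {D P₁ N P₂ : Matrix (Fin m) (Fin m) K[X]} {s r : Fin m → ℕ}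

lemma IsWeakPopov.exists_blockDegrees (h : IsWeakPopov (blockMatrix D P₁ N P₂)) :
    ∃ s r : Fin m → ℕ, BlockDegrees D P₁ N P₂ s r := by
  obtain ⟨t, ht, hd, hu⟩ := h.exists_degrees
  refine ⟨fun j => t (Fin.castAdd m j), fun j => t (Fin.natAdd m j), ?_, ?_, ?_, ?_, ?_, ?_, ?_,
    ?_⟩
  · intro i j
    simpa only [blockMatrix_castAdd_castAdd] using ht (Fin.castAdd m i) (Fin.castAdd m j)
  · intro i j
    have h1 := ht (Fin.natAdd m i) (Fin.castAdd m j)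
    have h2 := hu (Fin.natAdd m i) (Fin.castAdd m j) (by
      simp only [Fin.lt_def, Fin.val_castAdd, Fin.val_natAdd]; omega)
    rw [blockMatrix_natAdd_castAdd] at h1 h2
    exact degree_lt_of_coeff_eq_zero h1 h2
  · intro i j
    simpa only [blockMatrix_castAdd_natAdd] using ht (Fin.castAdd m i) (Fin.natAdd m j)
  · intro i j
    simpa only [blockMatrix_natAdd_natAdd] using ht (Fin.natAdd m i) (Fin.natAdd m j)
  · intro i j hij
    simpa only [coeffMatrix, Matrix.of_apply, blockMatrix_castAdd_castAdd] using
      hu (Fin.castAdd m i) (Fin.castAdd m j) (by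
        have : j < i := hij
        exact this)
  · intro j
    simpa only [blockMatrix_castAdd_castAdd] using hd (Fin.castAdd m j)
  · intro i j hij
    simpa only [coeffMatrix, Matrix.of_apply, blockMatrix_natAdd_natAdd] using
      hu (Fin.natAdd m i) (Fin.natAdd m j) (by
        have : j < i := hij
        simp only [Fin.lt_def, Fin.val_natAdd] at this ⊢
        omega)
  · intro j
    simpa only [blockMatrix_natAdd_natAdd] using hd (Fin.natAdd m j)

namespace BlockDegrees

lemma colDegree_right (h : BlockDegrees D P₁ N P₂ s r) (j : Fin m) :
    colDegree (blockMatrix D P₁ N P₂) (Fin.natAdd m j) = r j := by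
  refine colDegree_eq_of_coeff_ne_zero (i := Fin.natAdd m j) (fun i => ?_) ?_
  · refine Fin.addCases (fun i => ?_) (fun i => ?_) i
    · rw [blockMatrix_castAdd_natAdd]; exact h.natDegree_P₁ i j
    · rw [blockMatrix_natAdd_natAdd]; exact h.natDegree_P₂ i j
  · rw [blockMatrix_natAdd_natAdd]; exact h.diag_P₂ j

lemma degree_diag (h : BlockDegrees D P₁ N P₂ s r) (j : Fin m) : (D j j).degree = s j :=
  degree_eq_of_coeff_ne_zero (h.natDegree_D j j) (h.diag_D j)

lemma natDegree_det (h : BlockDegrees D P₁ N P₂ s r) :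
    D.det ≠ 0 ∧ D.det.natDegree = ∑ j, s j :=
  natDegree_det_of_coeffMatrix h.natDegree_D (det_ne_zero_of_diag_ne_zero h.upper_D h.diag_D)

lemma exists_perm_le (h : BlockDegrees D P₁ N P₂ s r) {U V B E : Matrix (Fin m) (Fin m) K[X]}
    {t : Fin m → ℕ} (hB : D * U + P₁ * V = B) (hE : N * U + P₂ * V = E)
    (hBt : ∀ i j, (B i j).natDegree ≤ t j) (hBdet : (coeffMatrix t B).det ≠ 0)
    (hEt : ∀ i j, (E i j).degree < t j) :
    (∃ σ : Equiv.Perm (Fin m), ∀ j, s (σ j) ≤ t j) ∧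
      ∀ i j, V i j = 0 ∨ r i + (V i j).natDegree < t j :=
  exists_perm_le_of_block_mul h.natDegree_D h.degree_N h.natDegree_P₁ h.natDegree_P₂
    (det_ne_zero_of_diag_ne_zero h.upper_D h.diag_D)
    (det_ne_zero_of_diag_ne_zero h.upper_P₂ h.diag_P₂) hB hE hBt hBdet hEt

end BlockDegrees

end BlockDegrees

/-! ### The denominator module. -/

section Module

variable {m : ℕ} {H : Matrix (Fin m) (Fin m) (RatFunc K)}

lemma toRat_mul {a b c : ℕ} (A : Matrix (Fin a) (Fin b) K[X]) (B : Matrix (Fin b) (Fin c) K[X]) :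
    toRat (A * B) = toRat A * toRat B :=
  Matrix.map_mul

lemma det_toRat_ne_zero {A : Matrix (Fin m) (Fin m) K[X]} (h : A.det ≠ 0) :
    (toRat A).det ≠ 0 := by
  have : (toRat A).det = algebraMap K[X] (RatFunc K) A.det := (RingHom.map_det _ _).symm
  rw [this]
  exact RatFunc.algebraMap_ne_zero h

lemma sum_mul_of_mul_toRat {B E : Matrix (Fin m) (Fin m) K[X]} (h : H * toRat B = toRat E)
    (i j : Fin m) : ∑ k, H i k * algebraMap K[X] (RatFunc K) (B k j) =
      algebraMap K[X] (RatFunc K) (E i j) :=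
  congrFun (congrFun h i) j

lemma col_mem_denomModule {B E : Matrix (Fin m) (Fin m) K[X]} (h : H * toRat B = toRat E)
    (j : Fin m) : B.col j ∈ denomModule H :=
  ⟨fun i => E i j, funext fun i => sum_mul_of_mul_toRat h i j⟩

lemma exists_mul_toRat_of_col_mem {B : Matrix (Fin m) (Fin m) K[X]}
    (h : ∀ j, B.col j ∈ denomModule H) :
    ∃ E : Matrix (Fin m) (Fin m) K[X], H * toRat B = toRat E := by
  choose E hE using h
  exact ⟨Matrix.of fun i j => E j i, by ext i j; exact congrFun (hE j) i⟩

/-- A common denominator `q` of the entries gives `q` times the identity. This makes the set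
defining `determinantalDegree` nonempty, so its infimum is attained. -/
lemma exists_nonsingular_cols_mem_denomModule (H : Matrix (Fin m) (Fin m) (RatFunc K)) :
    ∃ B : Matrix (Fin m) (Fin m) K[X], B.det ≠ 0 ∧ ∀ j, B.col j ∈ denomModule H := by
  classical
  obtain ⟨q, hq⟩ := IsLocalization.exist_integer_multiples_of_finset (nonZeroDivisors K[X])
    (Finset.univ.image fun p : Fin m × Fin m => H p.1 p.2)
  have hq' : ∀ i j, ∃ p : K[X], algebraMap K[X] (RatFunc K) p =
      H i j * algebraMap K[X] (RatFunc K) q := fun i j => by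
    obtain ⟨p, hp⟩ := hq (H i j) (Finset.mem_image_of_mem _ (Finset.mem_univ (i, j)))
    exact ⟨p, by rw [hp, Algebra.smul_def, mul_comm]⟩
  choose E hE using hq'
  refine ⟨Matrix.diagonal fun _ => (q : K[X]), ?_, fun j => ?_⟩
  · rw [Matrix.det_diagonal]
    exact Finset.prod_ne_zero_iff.2 fun _ _ => nonZeroDivisors.coe_ne_zero q
  · refine col_mem_denomModule (E := Matrix.of E) ?_ j
    ext i j
    have : toRat (Matrix.diagonal fun _ => (q : K[X])) =
        Matrix.diagonal fun _ : Fin m => algebraMap K[X] (RatFunc K) q := by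
      rw [toRat, Matrix.diagonal_map (map_zero _)]
    rw [this, Matrix.mul_diagonal]
    exact (hE i j).symm

lemma exists_det_eq_determinantalDegree (H : Matrix (Fin m) (Fin m) (RatFunc K)) :
    ∃ B : Matrix (Fin m) (Fin m) K[X], B.det ≠ 0 ∧ (∀ j, B.col j ∈ denomModule H) ∧
      B.det.natDegree = determinantalDegree (denomModule H) := by
  obtain ⟨B, h0, h1⟩ := exists_nonsingular_cols_mem_denomModule H
  exact Nat.sInf_mem (s := {n | ∃ B : Matrix (Fin m) (Fin m) K[X],
    B.det ≠ 0 ∧ (∀ j, B.col j ∈ denomModule H) ∧ B.det.natDegree = n}) ⟨_, B, h0, h1, rfl⟩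

/-- A nonsingular matrix with columns in `denomModule H` can be made column reduced, without
raising its degree or changing the degree of its determinant. -/
lemma exists_columnReduced_denominator {B : Matrix (Fin m) (Fin m) K[X]} {e : ℕ}
    (hH : IsStrictlyProper H) (hB : B.det ≠ 0) (hM : ∀ j, B.col j ∈ denomModule H)
    (he : ∀ i j, (B i j).natDegree ≤ e) :
    ∃ (B' E : Matrix (Fin m) (Fin m) K[X]) (t : Fin m → ℕ), H * toRat B' = toRat E ∧
      B'.det ≠ 0 ∧ B'.det.natDegree = B.det.natDegree ∧ (∀ i j, (B' i j).natDegree ≤ t j) ∧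
      (∀ j, t j ≤ e) ∧ (coeffMatrix t B').det ≠ 0 ∧ ∀ i j, (E i j).degree < t j := by
  obtain ⟨B', t, h0, h1, h2, h3, h4, h5⟩ := exists_columnReduced (fun _ => e) hB hM he
    fun _ => le_rfl
  obtain ⟨E, hE⟩ := exists_mul_toRat_of_col_mem h2
  exact ⟨B', E, t, hE, h0, h1, h3, h4, h5, fun i j => degree_lt_of_sum_mul
    (fun _ h => hH.intDegree_neg h) (fun k => h3 k j) (sum_mul_of_mul_toRat hE i j)⟩

end Module

/-! ### Approximant bases and fraction descriptions. -/

section Approximant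

variable {m : ℕ} {H : Matrix (Fin m) (Fin m) (RatFunc K)} {S : ℕ → Matrix (Fin m) (Fin m) K}
  {D P₁ N P₂ : Matrix (Fin m) (Fin m) K[X]} {σ : ℕ}

lemma HasPowerSeriesExpansion.append_mem (hS : HasPowerSeriesExpansion H S) (σ : ℕ)
    {B E : Matrix (Fin m) (Fin m) K[X]} (h : H * toRat B = toRat E) (j : Fin m) :
    Fin.append (fun i => B i j) (fun i => E i j) ∈
      approximantModule (toPowerSeries (blockRow (truncation S σ) (-1))) σ := by
  rw [mem_approximantModule_blockRow]
  intro i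
  simp only [Fin.append_left, Fin.append_right]
  rw [hS.sum_mul (fun _ => i) (fun k => k) (fun k => B k j) (E i j)
    (sum_mul_of_mul_toRat h i j), sub_self]
  exact dvd_zero _

lemma blockMatrix_mulVec_append (U V : Matrix (Fin m) (Fin m) K[X]) (j : Fin m) :
    (blockMatrix D P₁ N P₂).mulVec (Fin.append (fun i => U i j) fun i => V i j) =
      Fin.append (fun i => (D * U + P₁ * V) i j) fun i => (N * U + P₂ * V) i j := by
  ext i
  refine Fin.addCases (fun i => ?_) (fun i => ?_) i
  · simp only [Matrix.mulVec, dotProduct, Fin.sum_univ_add, blockMatrix_castAdd_castAdd,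
      blockMatrix_castAdd_natAdd, Fin.append_left, Fin.append_right]
    rfl
  · simp only [Matrix.mulVec, dotProduct, Fin.sum_univ_add, blockMatrix_natAdd_castAdd,
      blockMatrix_natAdd_natAdd, Fin.append_left, Fin.append_right]
    rfl

lemma IsApproximantBasis.exists_block_mul {F : Matrix (Fin m) (Fin (m + m)) (PowerSeries K)}
    (hP : IsApproximantBasis (blockMatrix D P₁ N P₂) F σ) {B E : Matrix (Fin m) (Fin m) K[X]}
    (h : ∀ j, Fin.append (fun i => B i j) (fun i => E i j) ∈ approximantModule F σ) :
    ∃ U V : Matrix (Fin m) (Fin m) K[X], D * U + P₁ * V = B ∧ N * U + P₂ * V = E := by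
  have hex : ∀ j, ∃ c, (blockMatrix D P₁ N P₂).mulVec c =
      Fin.append (fun i => B i j) (fun i => E i j) := fun j => by
    have := h j
    rw [← hP.2, ← Matrix.range_mulVecLin] at this
    exact this
  choose c hc using hex
  refine ⟨Matrix.of fun i j => c j (Fin.castAdd m i), Matrix.of fun i j => c j (Fin.natAdd m i),
    ?_⟩
  have key : ∀ j, _ := fun j => (blockMatrix_mulVec_append (D := D) (P₁ := P₁) (N := N)
    (P₂ := P₂) (Matrix.of fun i j => c j (Fin.castAdd m i))
    (Matrix.of fun i j => c j (Fin.natAdd m i)) j).symm.trans ((congrArg _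
      (show Fin.append (fun i => c j (Fin.castAdd m i)) (fun i => c j (Fin.natAdd m i)) = c j from
        Fin.append_castAdd_natAdd)).trans (hc j))
  constructor
  · ext1 i j
    simpa only [Fin.append_left] using congrFun (key j) (Fin.castAdd m i)
  · ext1 i j
    simpa only [Fin.append_right] using congrFun (key j) (Fin.natAdd m i)

lemma IsApproximantBasis.eq_one_of_block_mul {F : Matrix (Fin m) (Fin (m + m)) (PowerSeries K)}
    (hP : IsApproximantBasis (blockMatrix D P₁ N P₂) F σ) {U V : Matrix (Fin m) (Fin m) K[X]}
    (hD : D * U + P₁ * V = D) (hN : N * U + P₂ * V = N) : U = 1 := by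
  ext1 i j
  have hinj := Matrix.mulVec_injective_iff.2 hP.1
  have h1 := blockMatrix_mulVec_append (D := D) (P₁ := P₁) (N := N) (P₂ := P₂) U V j
  have h2 := blockMatrix_mulVec_append (D := D) (P₁ := P₁) (N := N) (P₂ := P₂) 1 0 j
  rw [hD, hN] at h1
  rw [mul_one, mul_one, mul_zero, mul_zero, add_zero, add_zero] at h2
  have := congrFun (hinj (h1.trans h2.symm)) (Fin.castAdd m i)
  simpa only [Fin.append_left] using this

lemma IsApproximantBasis.col_mem {F : Matrix (Fin m) (Fin (m + m)) (PowerSeries K)}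
    (hP : IsApproximantBasis (blockMatrix D P₁ N P₂) F σ) (k : Fin (m + m)) :
    (blockMatrix D P₁ N P₂).col k ∈ approximantModule F σ :=
  hP.2 ▸ Submodule.subset_span ⟨k, rfl⟩

/-- For a common right divisor `G`, cancellation gives `H D' = N'`, so `(D'; N') = P (U; V)`.
Multiplying by `G` expresses the left columns of `P` in the basis `P` itself, whence `U G = 1`. -/
lemma isIrreducibleRightFraction_of_mul_eq (hS : HasPowerSeriesExpansion H S)
    (hP : IsApproximantBasis (blockMatrix D P₁ N P₂)
      (toPowerSeries (blockRow (truncation S σ) (-1))) σ)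
    (hD : D.det ≠ 0) (h : H * toRat D = toRat N) : IsIrreducibleRightFraction N D H := by
  have hu := (det_toRat_ne_zero hD).isUnit
  refine ⟨⟨hD, ?_⟩, fun G N' D' hN' hD' => ?_⟩
  · rw [← h, Matrix.mul_nonsing_inv_cancel_right _ _ hu]
  · have hG : (toRat G).det ≠ 0 := by
      refine det_toRat_ne_zero fun h0 => hD ?_
      rw [hD', Matrix.det_mul, h0, mul_zero]
    have h' : H * toRat D' = toRat N' := by
      rw [hN', hD', toRat_mul, toRat_mul, ← mul_assoc] at h
      have := congrArg (· * (toRat G)⁻¹) h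
      simpa only [Matrix.mul_nonsing_inv_cancel_right _ _ hG.isUnit] using this
    obtain ⟨U, V, hU, hV⟩ := hP.exists_block_mul (hS.append_mem σ h')
    have h1 : U * G = 1 := by
      refine hP.eq_one_of_block_mul (V := V * G) ?_ ?_
      · rw [← mul_assoc, ← mul_assoc, ← add_mul, hU, ← hD']
      · rw [← mul_assoc, ← mul_assoc, ← add_mul, hV, ← hN']
    exact (Matrix.isUnit_iff_isUnit_det _).1 (IsUnit.of_mul_eq_one_right _ h1)

lemma degree_mul_lt_two_mul {p q : K[X]} {d : ℕ} (hp : p.degree < d) (hq : q.natDegree ≤ d) :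
    (p * q).degree < (2 * d : ℕ) := by
  by_cases h : p = 0
  · rw [h, zero_mul, degree_zero]; exact WithBot.bot_lt_coe _
  by_cases h' : q = 0
  · rw [h', mul_zero, degree_zero]; exact WithBot.bot_lt_coe _
  rw [degree_eq_natDegree h] at hp
  rw [degree_eq_natDegree (mul_ne_zero h h'), natDegree_mul h h']
  have : p.natDegree < d := by exact_mod_cast hp
  exact_mod_cast (by omega : p.natDegree + q.natDegree < 2 * d)

lemma coe_mulVec_sub_mulVec {A M : Matrix (Fin m) (Fin m) K[X]}
    {h : Matrix (Fin m) (Fin m) (PowerSeries K)}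
    (hM : ∀ i j, ∑ l, h l j * (A i l : PowerSeries K) = M i j) (v w : Fin m → K[X]) (i : Fin m) :
    ((M.mulVec v i - A.mulVec w i : K[X]) : PowerSeries K) =
      ∑ l, (A i l : PowerSeries K) *
        (∑ j, h l j * (v j : PowerSeries K) - (w l : PowerSeries K)) := by
  have hcoe : ∀ f : Fin m → K[X], ((∑ k, f k : K[X]) : PowerSeries K) =
      ∑ k, (f k : PowerSeries K) := fun f =>
    map_sum (coeToPowerSeries.ringHom (R := K)) f Finset.univ
  simp only [Matrix.mulVec, dotProduct, coe_sub, hcoe, coe_mul, ← hM, mul_sub,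
    Finset.sum_sub_distrib, Finset.mul_sum, Finset.sum_mul]
  rw [Finset.sum_comm]
  congr 1
  exact Finset.sum_congr rfl fun _ _ => Finset.sum_congr rfl fun _ _ => by ring

/-- When `H` has a left description in degree `d`, the vectors of degrees `(≤ d, < d)` of the
approximant module at order `2 d` give values of `H`. -/
lemma sum_mul_eq_of_mem_approximantModule (hH : IsStrictlyProper H)
    (hS : HasPowerSeriesExpansion H S) {d : ℕ} {A M : Matrix (Fin m) (Fin m) K[X]}
    (hA : IsLeftFraction A M H) (hAd : matDegree A ≤ (d : WithBot ℕ)) {u : Fin (m + m) → K[X]}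
    (hu : u ∈ approximantModule
      (toPowerSeries (blockRow (truncation S (2 * d)) (-1))) (2 * d))
    (hv : ∀ j, (u (Fin.castAdd m j)).natDegree ≤ d) (hw : ∀ i, (u (Fin.natAdd m i)).degree < d)
    (i : Fin m) :
    ∑ j, H i j * algebraMap K[X] (RatFunc K) (u (Fin.castAdd m j)) =
      algebraMap K[X] (RatFunc K) (u (Fin.natAdd m i)) := by
  have hdet := det_toRat_ne_zero hA.1
  have hAH : toRat A * H = toRat M := by
    rw [hA.2, Matrix.mul_nonsing_inv_cancel_left _ _ hdet.isUnit]
  have hAn : ∀ i j, (A i j).natDegree ≤ d := fun i j =>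
    natDegree_le_iff_degree_le.2 (matDegree_le_iff.1 hAd i j)
  have hrow : ∀ i j, ∑ l, H l j * algebraMap K[X] (RatFunc K) (A i l) =
      algebraMap K[X] (RatFunc K) (M i j) := fun i j => by
    rw [Finset.sum_congr rfl fun l _ => mul_comm _ _]
    exact congrFun (congrFun hAH i) j
  -- Strict properness, applied to the rows of `A H = M`. The strict bound is what makes order `2 *
  -- d` sufficient.
  have hMd : ∀ i j, (M i j).degree < d := fun i j =>
    degree_lt_of_sum_mul (fun _ h => hH.intDegree_neg h) (hAn i) (hrow i j)
  rw [mem_approximantModule_blockRow] at hu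
  set v : Fin m → K[X] := fun j => u (Fin.castAdd m j)
  set w : Fin m → K[X] := fun i => u (Fin.natAdd m i)
  have hMA : M.mulVec v = A.mulVec w := by
    ext1 i
    rw [← sub_eq_zero]
    apply eq_zero_of_X_pow_dvd_coe (σ := 2 * d)
    · rw [← mem_degreeLT]
      simp only [Matrix.mulVec, dotProduct]
      refine Submodule.sub_mem _ (Submodule.sum_mem _ fun j _ => ?_)
        (Submodule.sum_mem _ fun j _ => ?_)
      · exact mem_degreeLT.2 (degree_mul_lt_two_mul (hMd i j) (hv j))
      · rw [mul_comm (A i j)]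
        exact mem_degreeLT.2 (degree_mul_lt_two_mul (hw j) (hAn i j))
    · rw [coe_mulVec_sub_mulVec (h := Matrix.of fun l k => PowerSeries.mk fun n => S n l k)
        (fun i j => hS.sum_mul (fun l => l) (fun _ => j) (A i) (M i j) (hrow i j))]
      exact Finset.dvd_sum fun l _ => (hu l).mul_left _
  have hzero : H.mulVec (fun j => algebraMap K[X] (RatFunc K) (v j)) =
      fun i => algebraMap K[X] (RatFunc K) (w i) := by
    have hmap : ∀ (L : Matrix (Fin m) (Fin m) K[X]) (z : Fin m → K[X]),
        (toRat L).mulVec (fun j => algebraMap K[X] (RatFunc K) (z j)) =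
          fun i => algebraMap K[X] (RatFunc K) (L.mulVec z i) := fun L z => by
      ext1 i
      exact (RingHom.map_mulVec (algebraMap K[X] (RatFunc K)) L z i).symm
    rw [← sub_eq_zero]
    refine Matrix.eq_zero_of_mulVec_eq_zero hdet ?_
    rw [Matrix.mulVec_sub, Matrix.mulVec_mulVec, hAH, hmap, hmap, hMA, sub_self]
  exact congrFun hzero i

end Approximant

/-! ### Comparison with minimal, right and left denominators. -/

variable {m : ℕ} {H : Matrix (Fin m) (Fin m) (RatFunc K)}
  {S : ℕ → Matrix (Fin m) (Fin m) K} {D P₁ N P₂ : Matrix (Fin m) (Fin m) K[X]} {s r : Fin m → ℕ}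

/-- A column reduced denominator of minimal determinantal degree, written in terms of an
approximant basis. -/
lemma exists_minimal_denominator (hH : IsStrictlyProper H) (hS : HasPowerSeriesExpansion H S)
    {σ : ℕ} (hP : IsApproximantBasis (blockMatrix D P₁ N P₂)
      (toPowerSeries (blockRow (truncation S σ) (-1))) σ)
    (hdeg : BlockDegrees D P₁ N P₂ s r) :
    ∃ (B E U V : Matrix (Fin m) (Fin m) K[X]) (t : Fin m → ℕ) (τ : Equiv.Perm (Fin m)),
      H * toRat B = toRat E ∧ D * U + P₁ * V = B ∧ N * U + P₂ * V = E ∧ B.det ≠ 0 ∧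
      B.det.natDegree = determinantalDegree (denomModule H) ∧ ∑ j, t j = B.det.natDegree ∧
      (∀ j, s (τ j) ≤ t j) ∧ ∀ i j, V i j = 0 ∨ r i + (V i j).natDegree < t j := by
  obtain ⟨B₀, h0, h1, h2⟩ := exists_det_eq_determinantalDegree H
  -- Any degree bound `e` for `B₀` would do: only the sum of the reduced column degrees matters.
  obtain ⟨B, E, t, hBE, hB, hBdeg, hBt, -, hred, hE⟩ := exists_columnReduced_denominator
    (e := Finset.univ.sup fun i => Finset.univ.sup fun j => (B₀ i j).natDegree) hH h0 h1
    fun i j => (Finset.le_sup (f := fun j => (B₀ i j).natDegree) (Finset.mem_univ j)).trans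
      (Finset.le_sup (f := fun i => Finset.univ.sup fun j => (B₀ i j).natDegree)
        (Finset.mem_univ i))
  obtain ⟨U, V, hU, hV⟩ := hP.exists_block_mul (hS.append_mem σ hBE)
  obtain ⟨⟨τ, hτ⟩, hVd⟩ := hdeg.exists_perm_le hU hV hBt hred hE
  exact ⟨B, E, U, V, t, τ, hBE, hU, hV, hB, hBdeg.trans h2,
    (natDegree_det_of_coeffMatrix hBt hred).2.symm, hτ, hVd⟩

lemma mul_toRat_eq_of_degree_det_eq (hH : IsStrictlyProper H) (hS : HasPowerSeriesExpansion H S)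
    {σ : ℕ} (hP : IsApproximantBasis (blockMatrix D P₁ N P₂)
      (toPowerSeries (blockRow (truncation S σ) (-1))) σ)
    (hdeg : BlockDegrees D P₁ N P₂ s r)
    (hδ : D.det.natDegree = determinantalDegree (denomModule H)) (hr : ∀ i j, s i ≤ r j) :
    H * toRat D = toRat N := by
  obtain ⟨B, E, U, V, t, τ, hBE, hU, hV, hB, hBdeg, hsum, hτ, hVd⟩ :=
    exists_minimal_denominator hH hS hP hdeg
  have heq : ∀ j, s (τ j) = t j := by
    have hs : ∑ j, s (τ j) = ∑ j, t j := by
      rw [Equiv.sum_comp τ s, ← hdeg.natDegree_det.2, hδ, hsum, hBdeg]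
    exact fun j => (Finset.sum_eq_sum_iff_of_le fun j _ => hτ j).1 hs j (Finset.mem_univ j)
  -- A nonzero entry would give `r i < t j = s (τ j) ≤ r i`.
  have hV0 : V = 0 := by
    ext1 i j
    refine (hVd i j).resolve_right fun h => ?_
    have := hr (τ j) i
    have := heq j
    omega
  rw [hV0, mul_zero, add_zero] at hU hV
  have hUdet : U.det ≠ 0 := fun h0 => hB (by rw [← hU, Matrix.det_mul, h0, mul_zero])
  rw [← hU, ← hV, toRat_mul, toRat_mul, ← mul_assoc] at hBE
  have := congrArg (· * (toRat U)⁻¹) hBE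
  simpa only [Matrix.mul_nonsing_inv_cancel_right _ _ (det_toRat_ne_zero hUdet).isUnit] using this

/-- The left columns of the approximant basis have degree at most the degree of any right
description. -/
lemma degrees_le_of_isRightFraction (hH : IsStrictlyProper H) (hS : HasPowerSeriesExpansion H S)
    {σ : ℕ} (hP : IsApproximantBasis (blockMatrix D P₁ N P₂)
      (toPowerSeries (blockRow (truncation S σ) (-1))) σ)
    (hdeg : BlockDegrees D P₁ N P₂ s r) {A M : Matrix (Fin m) (Fin m) K[X]} {d : ℕ}
    (hA : IsRightFraction M A H) (hAd : matDegree A ≤ (d : WithBot ℕ)) (j : Fin m) : s j ≤ d := by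
  have hHA : H * toRat A = toRat M := by
    rw [hA.2, Matrix.nonsing_inv_mul_cancel_right _ _ (det_toRat_ne_zero hA.1).isUnit]
  obtain ⟨B, E, t, hBE, -, -, hBt, ht, hred, hE⟩ := exists_columnReduced_denominator
    (e := d) hH hA.1 (col_mem_denomModule hHA)
    fun i j => natDegree_le_iff_degree_le.2 (matDegree_le_iff.1 hAd i j)
  obtain ⟨U, V, hU, hV⟩ := hP.exists_block_mul (hS.append_mem σ hBE)
  obtain ⟨⟨τ, hτ⟩, -⟩ := hdeg.exists_perm_le hU hV hBt hred hE
  have := (hτ (τ.symm j)).trans (ht _)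
  rwa [Equiv.apply_symm_apply] at this

lemma mul_toRat_eq_of_isLeftFraction (hH : IsStrictlyProper H) (hS : HasPowerSeriesExpansion H S)
    {d : ℕ} (hP : IsApproximantBasis (blockMatrix D P₁ N P₂)
      (toPowerSeries (blockRow (truncation S (2 * d)) (-1))) (2 * d))
    (hdeg : BlockDegrees D P₁ N P₂ s r) {A M : Matrix (Fin m) (Fin m) K[X]}
    (hA : IsLeftFraction A M H) (hAd : matDegree A ≤ (d : WithBot ℕ)) (hs : ∀ j, s j ≤ d) :
    H * toRat D = toRat N := by
  ext1 i j
  have := sum_mul_eq_of_mem_approximantModule hH hS hA hAd (hP.col_mem (Fin.castAdd m j))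
    (fun k => by
      rw [Matrix.col_apply, blockMatrix_castAdd_castAdd]
      exact (hdeg.natDegree_D k j).trans (hs j))
    (fun k => by
      rw [Matrix.col_apply, blockMatrix_natAdd_castAdd]
      exact (hdeg.degree_N k j).trans_le (by exact_mod_cast hs j)) i
  simp only [Matrix.col_apply, blockMatrix_castAdd_castAdd, blockMatrix_natAdd_castAdd] at this
  exact this

/-- If `r j < d`, right column `j` satisfies `H v = w`; strict properness then makes `deg w < r j`,
contradicting the pivot on the diagonal of `P₂`. -/
lemma le_degrees_of_isLeftFraction (hH : IsStrictlyProper H) (hS : HasPowerSeriesExpansion H S)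
    {d : ℕ} (hP : IsApproximantBasis (blockMatrix D P₁ N P₂)
      (toPowerSeries (blockRow (truncation S (2 * d)) (-1))) (2 * d))
    (hdeg : BlockDegrees D P₁ N P₂ s r) {A M : Matrix (Fin m) (Fin m) K[X]}
    (hA : IsLeftFraction A M H) (hAd : matDegree A ≤ (d : WithBot ℕ)) (j : Fin m) : d ≤ r j := by
  by_contra! hlt
  have := sum_mul_eq_of_mem_approximantModule hH hS hA hAd (hP.col_mem (Fin.natAdd m j))
    (fun k => by
      rw [Matrix.col_apply, blockMatrix_castAdd_natAdd]
      exact (hdeg.natDegree_P₁ k j).trans hlt.le)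
    (fun k => by
      rw [Matrix.col_apply, blockMatrix_natAdd_natAdd]
      exact (natDegree_le_iff_degree_le.1 (hdeg.natDegree_P₂ k j)).trans_lt
        (by exact_mod_cast hlt)) j
  simp only [Matrix.col_apply, blockMatrix_castAdd_natAdd, blockMatrix_natAdd_natAdd] at this
  have hd := degree_lt_of_sum_mul (fun _ h => hH.intDegree_neg h)
    (fun k => hdeg.natDegree_P₁ k j) this
  exact hdeg.diag_P₂ j (coeff_eq_zero_of_degree_lt hd)

end MatFrac

end

theorem mainTheorem7 {K : Type*} [Field K] {m : ℕ} (hm : 0 < m) (d : ℕ)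
    (H : Matrix (Fin m) (Fin m) (RatFunc K)) (hH : MatFrac.IsStrictlyProper H)
    (S : ℕ → Matrix (Fin m) (Fin m) K) (hS : MatFrac.HasPowerSeriesExpansion H S)
    (D P₁ N P₂ : Matrix (Fin m) (Fin m) (Polynomial K))
    (hP : MatFrac.IsApproximantBasis (MatFrac.blockMatrix D P₁ N P₂)
      (MatFrac.toPowerSeries (MatFrac.blockRow (MatFrac.truncation S (2 * d)) (-1))) (2 * d))
    (hPopov : MatFrac.IsWeakPopov (MatFrac.blockMatrix D P₁ N P₂)) :
    (MatFrac.IsWeakPopov D ∧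
      MatFrac.matDegree N < MatFrac.matDegree D ∧
      D.det.degree = ∑ i, (D i i).degree ∧
      D.det.degree ≤ (MatFrac.determinantalDegree (MatFrac.denomModule H) : WithBot ℕ)) ∧
    (D.det.degree = (MatFrac.determinantalDegree (MatFrac.denomModule H) : WithBot ℕ) →
      (∀ j : Fin m, MatFrac.matDegree D ≤
        MatFrac.colDegree (MatFrac.blockMatrix D P₁ N P₂) (Fin.natAdd m j)) →
      MatFrac.IsIrreducibleRightFraction N D H) ∧
    (MatFrac.IsDescribable H d →
      MatFrac.IsIrreducibleRightFraction N D H ∧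
      MatFrac.matDegree D ≤ (d : WithBot ℕ) ∧
      ∀ j : Fin m, MatFrac.matDegree D ≤
        MatFrac.colDegree (MatFrac.blockMatrix D P₁ N P₂) (Fin.natAdd m j)) := by
  obtain ⟨s, r, hdeg⟩ := hPopov.exists_blockDegrees
  obtain ⟨hD, hDdeg⟩ := hdeg.natDegree_det
  have hdetdeg : D.det.degree = ((∑ j, s j : ℕ) : WithBot ℕ) := by
    rw [Polynomial.degree_eq_natDegree hD, hDdeg]
  refine ⟨⟨MatFrac.isWeakPopov_of_degrees hdeg.natDegree_D hdeg.diag_D hdeg.upper_D,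
    MatFrac.matDegree_lt_of_columns hm hdeg.degree_N hdeg.degree_diag, ?_, ?_⟩, ?_, ?_⟩
  · rw [hdetdeg, Nat.cast_sum]
    exact Finset.sum_congr rfl fun j _ => (hdeg.degree_diag j).symm
  · obtain ⟨B, E, U, V, t, τ, -, -, -, -, hBdeg, hsum, hτ, -⟩ :=
      MatFrac.exists_minimal_denominator hH hS hP hdeg
    rw [hdetdeg, ← hBdeg, ← hsum, ← Equiv.sum_comp τ s]
    exact_mod_cast Finset.sum_le_sum fun j _ => hτ j
  · intro hδ hr
    refine MatFrac.isIrreducibleRightFraction_of_mul_eq hS hP hD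
      (MatFrac.mul_toRat_eq_of_degree_det_eq hH hS hP hdeg
        (Polynomial.natDegree_eq_of_degree_eq_some hδ) fun i j => ?_)
    have h := hr j
    rw [hdeg.colDegree_right] at h
    have h' := (MatFrac.degree_le_matDegree D i i).trans h
    rw [hdeg.degree_diag] at h'
    exact_mod_cast h'
  · rintro ⟨⟨A, M, hA, hAd⟩, M', A', hA', hAd'⟩
    have hs := MatFrac.degrees_le_of_isRightFraction hH hS hP hdeg hA' hAd'
    have hDd : MatFrac.matDegree D ≤ (d : WithBot ℕ) := MatFrac.matDegree_le_iff.2 fun i j =>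
      Polynomial.natDegree_le_iff_degree_le.1 ((hdeg.natDegree_D i j).trans (hs j))
    refine ⟨MatFrac.isIrreducibleRightFraction_of_mul_eq hS hP hD
      (MatFrac.mul_toRat_eq_of_isLeftFraction hH hS hP hdeg hA hAd hs), hDd, fun j => ?_⟩
    rw [hdeg.colDegree_right]
    exact hDd.trans (by exact_mod_cast MatFrac.le_degrees_of_isLeftFraction hH hS hP hdeg hA hAd j)
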